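/- There is a universal constant $C$ such that the following holds. Consider an instance of two-stage stochastic metric uncapacitated facility location: a finite set $V$ of $n=|V|\ge 2$ cities and a finite non-empty set $F$ of facilities, located in a common (pseudo)metric space with distance $d$, with first-stage costs $w^I_j\ge 0$ and second-stage costs $w^{II}_j>w^I_j$ $(j\in F)$. For a first-stage decision $x\subseteq F$ (the facilities bought in the first stage) and a set $S\subseteq V$ of cities to be served, let $$f(x,S)=\sum_{j\in x}w^I_j+c(x,S),\qquad c(x,S)=\min_{A,\sigma}\Bigl(\sum_{j\in A\setminus x}w^{II}_j+\sum_{i\in S}d(i,\sigma(i))\Bigr),$$ where the minimum is over all $A\subseteq F$ and all assignments $\sigma$ of the cities in $S$ to facilities in $A$ (so the facilities in $x$ are free in the second stage). Let $p_i\in[0,1]$ $(i\in V)$ be given marginal probabilities. Let $\mathcal L=\max_{\mathcal D}\mathbb E_{S\sim\mathcal D}[f(x,S)]$ be the worst-case expected cost, the maximum being over all distributions $\mathcal D$ of a random set $S\subseteq V$ with $\Pr_{\mathcal D}(i\in S)=p_i$ for every $i\in V$, and let $\mathcal I$ be the expected cost $\mathbb E[f(x,S)]$ when every $i\in V$ belongs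 to $S$ independently with probability $p_i$. Then, for every decision $x\subseteq F$ and all marginals $(p_i)$, the correlation gap satisfies $$\frac{\mathcal L}{\mathcal I}\le C\log n ,$$ and $\mathcal L=0$ whenever $\mathcal I=0$ (in which case the ratio $0/0$ is read as $0$). That is, the correlation gap of stochastic uncapacitated facility location is $O(\log n)$. -/

import Mathlib

/-! ### Random demand sets, worst-case and independent distributions, correlation gap -/

noncomputable section

/-- The distributions of a random set `S ⊆ V` (given by the probabilities `α S`) under which
every element `i` appears in `S` with probability `p i`. -/
def distributionsWithMarginals {V : Type*} [Fintype V] [DecidableEq V] (p : V → ℝ) :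
    Set (Finset V → ℝ) :=
  {α | α ∈ stdSimplex ℝ (Finset V) ∧ ∀ i, ∑ S with i ∈ S, α S = p i}

/-- The expectation of `f S` when the random set `S` has distribution `α`. -/
def expectedCost {V : Type*} [Fintype V] (α : Finset V → ℝ) (f : Finset V → ℝ) : ℝ :=
  ∑ S, α S * f S

/-- The independent Bernoulli (product) distribution with marginals `p`. -/
def independentDistribution {V : Type*} [Fintype V] [DecidableEq V] (p : V → ℝ) :
    Finset V → ℝ :=
  fun S => ∏ i, if i ∈ S then p i else 1 - p i

/-- The expected cost under the independent distribution with marginals `p`. -/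
def independentCost {V : Type*} [Fintype V] [DecidableEq V] (f : Finset V → ℝ) (p : V → ℝ) : ℝ :=
  expectedCost (independentDistribution p) f

/-- The expected cost under the worst-case distribution with marginals `p`
(a maximum whenever all `p i` lie in `[0,1]`, see `isGreatest_worstCaseCost`). -/
def worstCaseCost {V : Type*} [Fintype V] [DecidableEq V] (f : Finset V → ℝ) (p : V → ℝ) : ℝ :=
  sSup ((fun α => expectedCost α f) '' distributionsWithMarginals p)

/-- The correlation gap of the instance `(f, V, p)`. -/
def correlationGap {V : Type*} [Fintype V] [DecidableEq V] (f : Finset V → ℝ) (p : V → ℝ) : ℝ :=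
  worstCaseCost f p / independentCost f p

theorem independentDistribution_eq {V : Type*} [Fintype V] [DecidableEq V] (p : V → ℝ)
    (S : Finset V) :
    independentDistribution p S = (∏ i ∈ S, p i) * ∏ i ∈ Finset.univ \ S, (1 - p i) := by
  unfold independentDistribution
  rw [Finset.prod_ite]
  congr 2
  · ext i; simp
  · ext i; simp

theorem independentDistribution_mem {V : Type*} [Fintype V] [DecidableEq V] {p : V → ℝ}
    (hp : ∀ i, p i ∈ Set.Icc (0 : ℝ) 1) :
    independentDistribution p ∈ distributionsWithMarginals p := by
  refine ⟨⟨fun S => ?_, ?_⟩, fun i => ?_⟩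
  · refine Finset.prod_nonneg fun i _ => ?_
    split_ifs
    · exact (hp i).1
    · linarith [(hp i).2]
  · have h := Finset.prod_add p (fun i => 1 - p i) Finset.univ
    simp only [add_sub_cancel, Finset.prod_const_one, Finset.powerset_univ] at h
    simpa only [independentDistribution_eq] using h.symm
  · have h := Finset.prod_add p (fun j => if j = i then 0 else 1 - p j) Finset.univ
    rw [Finset.powerset_univ] at h
    have h1 : ∏ j, (p j + if j = i then 0 else 1 - p j) = p i := by
      rw [Finset.prod_eq_single i]
      · simp
      · intro j _ hj; simp [hj]
      · simp
    rw [h1] at h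
    rw [h, Finset.sum_filter]
    refine Finset.sum_congr rfl fun S _ => ?_
    split_ifs with hS
    · rw [independentDistribution_eq]
      congr 1
      refine Finset.prod_congr rfl fun j hj => ?_
      have : j ≠ i := by rintro rfl; simp [hS] at hj
      simp [this]
    · symm
      apply mul_eq_zero_of_right
      exact Finset.prod_eq_zero (i := i) (by simp [hS]) (by simp)

theorem isGreatest_worstCaseCost {V : Type*} [Fintype V] [DecidableEq V] (f : Finset V → ℝ)
    {p : V → ℝ} (hp : ∀ i, p i ∈ Set.Icc (0 : ℝ) 1) :
    IsGreatest ((fun α => expectedCost α f) '' distributionsWithMarginals p)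
      (worstCaseCost f p) := by
  have hc : IsCompact (distributionsWithMarginals p) := by
    refine (isCompact_stdSimplex ℝ (Finset V)).inter_right
      (t := {α | ∀ i, ∑ S with i ∈ S, α S = p i}) ?_
    simp only [Set.ofPred_forall]
    exact isClosed_iInter fun i => isClosed_eq (by fun_prop) continuous_const
  have hcont : Continuous (fun α : Finset V → ℝ => expectedCost α f) := by
    unfold expectedCost; fun_prop
  exact (hc.image hcont).isGreatest_sSup (Set.Nonempty.image _ ⟨_, independentDistribution_mem hp⟩)

/-! ### Facility location -/

/-- An instance of two-stage stochastic (metric) uncapacitated facility location: cities `V` and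
facilities `F` are located in a common (pseudo)metric space `M`; facility `j` costs
`firstCost j` in the first stage and the higher price `secondCost j` in the second stage. -/
structure SUFLInstance (V F M : Type*) [PseudoMetricSpace M] where
  cityLoc : V → M
  facilityLoc : F → M
  firstCost : F → ℝ
  secondCost : F → ℝ
  firstCost_nonneg : ∀ j, 0 ≤ firstCost j
  firstCost_lt_secondCost : ∀ j, firstCost j < secondCost j

namespace SUFLInstance

variable {V F M : Type*} [PseudoMetricSpace M]

/-- The costs of the feasible solutions of deterministic facility location with opening costs `w`
and demand set `S`: open a set `A` of facilities, and assign every city `i ∈ S` to an open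
facility `σ i` at a cost equal to the distance. -/
def uflSolutionCosts (I : SUFLInstance V F M) (w : F → ℝ) (S : Finset V) : Set ℝ :=
  {r | ∃ (A : Finset F) (σ : V → F), (∀ i ∈ S, σ i ∈ A) ∧
    r = ∑ j ∈ A, w j + ∑ i ∈ S, dist (I.cityLoc i) (I.facilityLoc (σ i))}

/-- The optimal cost of deterministic facility location with opening costs `w` and demand `S`
(a minimum when there is a facility, see `isLeast_uflCost`). -/
def uflCost (I : SUFLInstance V F M) (w : F → ℝ) (S : Finset V) : ℝ :=
  sInf (I.uflSolutionCosts w S)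

theorem isLeast_uflCost [Fintype F] [Nonempty F] [Fintype V] (I : SUFLInstance V F M)
    (w : F → ℝ) (S : Finset V) : IsLeast (I.uflSolutionCosts w S) (I.uflCost w S) := by
  have hfin : (I.uflSolutionCosts w S).Finite := by
    refine (Set.finite_range fun q : Finset F × (V → F) => ∑ j ∈ q.1, w j +
      ∑ i ∈ S, dist (I.cityLoc i) (I.facilityLoc (q.2 i))).subset ?_
    rintro r ⟨A, σ, -, rfl⟩
    exact ⟨(A, σ), rfl⟩
  have hne : (I.uflSolutionCosts w S).Nonempty :=
    ⟨_, Finset.univ, fun _ => Classical.arbitrary F, fun _ _ => Finset.mem_univ _, rfl⟩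
  exact ⟨hne.csInf_mem hfin, fun _ hr => csInf_le hfin.bddBelow hr⟩

/-- The opening costs in the second stage when the facilities in `x` were bought in the first. -/
def secondStageOpeningCost [DecidableEq F] (I : SUFLInstance V F M) (x : Finset F) : F → ℝ :=
  fun j => if j ∈ x then 0 else I.secondCost j

/-- The total cost `f(x, S) = wᴵ · x + c(x, S)` of the first-stage decision `x` (the set of
facilities bought in the first stage) when the set `S` of cities has to be served. -/
def cost [DecidableEq F] (I : SUFLInstance V F M) (x : Finset F) (S : Finset V) : ℝ :=
  ∑ j ∈ x, I.firstCost j + I.uflCost (I.secondStageOpeningCost x) S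

end SUFLInstance

end

/-!
The correlation gap of metric facility location is in fact at most `6`; since
`log 2 ≤ log n`, the constant `C = 6 / log 2` suffices.

*Cost shares bound the gap.* Suppose the cost `g S` can be split into nonnegative shares `χ i S`,
`i ∈ S`, that never exceed `g S` in total, that recover at least `g S / β`, and that are
cross-monotone: the share of a city does not increase when the set grows. For sets `S` and `T`,
`g T ≤ g (S ∪ T) ≤ β * ∑ i ∈ S ∪ T, χ i (S ∪ T)`, and by cross-monotonicity this is at most
`β * (∑ i ∈ T, χ i (insert i S) + g S)`. Now average over an independent random `S` and a random `T`
from any distribution with the same marginals. By independence, the expectation of the first sum is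
`∑ i, p i * E[χ i (insert i S)] = E[∑ i ∈ S, χ i S] ≤ E[g S]`. Hence `E[g T] ≤ 2 * β * E[g S]`
(`expectedCost_le_of_crossMonotone`).

*Cost shares for facility location* (the scheme of Pál and Tardos, with `β = 3`). Let a ball grow at
unit speed around every city of `S`; the facility `j` is paid for at the time `t j` at which
`∑ i ∈ S, max 0 (t j - d i j) = w j`. The share of `i` is the first time at which its ball contains
a facility that is paid for, `min_j max (t j) (d i j)`. Larger sets pay earlier, so the shares are
cross-monotone, and they are at most the cost of any solution because
`∑ i ∈ A, (t j - d i j) ≤ w j` for all `A ⊆ S`. For cost recovery, select facilities greedily in the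
order of `t j`, skipping those too close to an earlier one (`exists_separated_net`): the balls of
radius `t j` about the selected facilities are disjoint, so a city helps to pay for at most one
of them, and three times its share covers that contribution and its connection
(`uflCost_le_three_mul_sum_costShare`).

The facilities bought in the first stage add the same constant to both expected costs, which does
not increase the ratio beyond the bound.
-/

noncomputable section

/-! ### Cross-monotone cost shares bound the correlation gap -/

section CostShares

variable {V : Type*} [DecidableEq V]

/-- Adding a set `T` to a set `S` is paid for by the shares of the cities of `T`, each of
which pays at least as much when it joins `S` alone. -/
theorem cost_le_of_crossMonotone {g : Finset V → ℝ} {χ : V → Finset V → ℝ} {β : ℝ} (hβ : 0 ≤ β)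
    (hmono : Monotone g) (hnonneg : ∀ S, ∀ i ∈ S, 0 ≤ χ i S)
    (hcross : ∀ S T, S ⊆ T → ∀ i ∈ S, χ i T ≤ χ i S)
    (hcomp : ∀ S, ∑ i ∈ S, χ i S ≤ g S) (hrec : ∀ S, g S ≤ β * ∑ i ∈ S, χ i S)
    (S T : Finset V) : g T ≤ β * (∑ i ∈ T, χ i (insert i S) + g S) := by
  refine (hmono (Finset.subset_union_right : T ⊆ S ∪ T)).trans ((hrec _).trans ?_)
  refine mul_le_mul_of_nonneg_left ?_ hβ
  have hsplit : ∑ i ∈ S ∪ T, χ i (S ∪ T) =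
      ∑ i ∈ T, χ i (S ∪ T) + ∑ i ∈ S \ T, χ i (S ∪ T) := by
    rw [← Finset.sum_union Finset.disjoint_sdiff, Finset.union_sdiff_self_eq_union,
      Finset.union_comm T S]
  rw [hsplit]
  refine add_le_add (Finset.sum_le_sum fun i hi => ?_) ?_
  · exact hcross _ _ (Finset.insert_subset (Finset.mem_union_right _ hi)
      Finset.subset_union_left) i (Finset.mem_insert_self i S)
  · calc ∑ i ∈ S \ T, χ i (S ∪ T) ≤ ∑ i ∈ S \ T, χ i S :=
          Finset.sum_le_sum fun i hi => hcross _ _ Finset.subset_union_left i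
            (Finset.mem_sdiff.mp hi).1
      _ ≤ ∑ i ∈ S, χ i S :=
          Finset.sum_le_sum_of_subset_of_nonneg Finset.sdiff_subset fun i hi _ => hnonneg S i hi
      _ ≤ g S := hcomp S

variable [Fintype V]

/-- Under the independent distribution, the event `i ∈ S` is independent of `S \ {i}`, hence of
`insert i S`. -/
theorem sum_independentDistribution_mem (p : V → ℝ) (i : V) (h : Finset V → ℝ) :
    ∑ S, independentDistribution p S * (if i ∈ S then h S else 0) =
      p i * ∑ S, independentDistribution p S * h (insert i S) := by
  have split : ∀ k : Finset V → ℝ, ∑ S, k S =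
      ∑ S ∈ (Finset.univ.erase i).powerset, k S +
        ∑ S ∈ (Finset.univ.erase i).powerset, k (insert i S) := by
    intro k
    rw [← Finset.sum_powerset_insert (Finset.notMem_erase i _),
      Finset.insert_erase (Finset.mem_univ i), Finset.powerset_univ]
  rw [split, split, ← Finset.sum_add_distrib, ← Finset.sum_add_distrib, Finset.mul_sum]
  refine Finset.sum_congr rfl fun S hS => ?_
  have hi : i ∉ S := fun hi => by simpa using Finset.mem_powerset.mp hS hi
  have h1 : independentDistribution p S =
      (1 - p i) * ∏ j ∈ Finset.univ.erase i, if j ∈ S then p j else 1 - p j := by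
    unfold independentDistribution
    rw [← Finset.mul_prod_erase _ _ (Finset.mem_univ i), if_neg hi]
  have h2 : independentDistribution p (insert i S) =
      p i * ∏ j ∈ Finset.univ.erase i, if j ∈ S then p j else 1 - p j := by
    unfold independentDistribution
    rw [← Finset.mul_prod_erase _ _ (Finset.mem_univ i), if_pos (Finset.mem_insert_self i S)]
    congr 1
    refine Finset.prod_congr rfl fun j hj => ?_
    simp [Finset.mem_insert, Finset.ne_of_mem_erase hj]
  rw [if_neg hi, if_pos (Finset.mem_insert_self i S), Finset.insert_idem, h1, h2]
  ring

theorem sum_mul_marginal {p : V → ℝ} {α : Finset V → ℝ} (hα : α ∈ distributionsWithMarginals p)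
    (X : V → ℝ) : ∑ i, p i * X i = ∑ T, α T * ∑ i ∈ T, X i := by
  have h : ∀ T : Finset V, α T * ∑ i ∈ T, X i = ∑ i, if i ∈ T then α T * X i else 0 := by
    intro T
    rw [Finset.mul_sum, ← Finset.sum_filter, Finset.filter_univ_mem]
  simp_rw [h]
  rw [Finset.sum_comm]
  refine Finset.sum_congr rfl fun i _ => ?_
  rw [← hα.2 i, Finset.sum_mul, Finset.sum_filter]

/-- A monotone cost function with cross-monotone cost shares that are competitive and recover a
`1 / β` fraction of the cost has correlation gap at most `2 * β`. -/
theorem expectedCost_le_of_crossMonotone {p : V → ℝ} (hp : ∀ i, p i ∈ Set.Icc (0 : ℝ) 1)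
    {α : Finset V → ℝ} (hα : α ∈ distributionsWithMarginals p)
    {g : Finset V → ℝ} {χ : V → Finset V → ℝ} {β : ℝ} (hβ : 0 ≤ β)
    (hmono : Monotone g) (hnonneg : ∀ S, ∀ i ∈ S, 0 ≤ χ i S)
    (hcross : ∀ S T, S ⊆ T → ∀ i ∈ S, χ i T ≤ χ i S)
    (hcomp : ∀ S, ∑ i ∈ S, χ i S ≤ g S) (hrec : ∀ S, g S ≤ β * ∑ i ∈ S, χ i S) :
    expectedCost α g ≤ 2 * β * independentCost g p := by
  obtain ⟨⟨hP0, hP1⟩, -⟩ := independentDistribution_mem hp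
  set P := independentDistribution p with hP
  set X : V → ℝ := fun i => ∑ S, P S * χ i (insert i S) with hX
  have hshares : ∑ i, p i * X i ≤ independentCost g p := by
    calc ∑ i, p i * X i = ∑ i, ∑ S, P S * (if i ∈ S then χ i S else 0) :=
          Finset.sum_congr rfl fun i _ => (sum_independentDistribution_mem p i (χ i)).symm
      _ = ∑ S, P S * ∑ i ∈ S, χ i S := by
          rw [Finset.sum_comm]
          refine Finset.sum_congr rfl fun S _ => ?_
          rw [← Finset.mul_sum, ← Finset.sum_filter, Finset.filter_univ_mem]
      _ ≤ independentCost g p :=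
          Finset.sum_le_sum fun S _ => mul_le_mul_of_nonneg_left (hcomp S) (hP0 S)
  have haverage : ∀ T, g T ≤ β * (∑ i ∈ T, X i + independentCost g p) := by
    intro T
    calc g T = ∑ S, P S * g T := by rw [← Finset.sum_mul, hP1, one_mul]
      _ ≤ ∑ S, P S * (β * (∑ i ∈ T, χ i (insert i S) + g S)) :=
          Finset.sum_le_sum fun S _ => mul_le_mul_of_nonneg_left
            (cost_le_of_crossMonotone hβ hmono hnonneg hcross hcomp hrec S T) (hP0 S)
      _ = β * (∑ i ∈ T, X i + independentCost g p) := by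
          simp only [hX, independentCost, expectedCost, ← hP]
          rw [Finset.sum_comm, ← Finset.sum_add_distrib, Finset.mul_sum]
          refine Finset.sum_congr rfl fun S _ => ?_
          rw [← Finset.mul_sum]
          ring
  calc expectedCost α g
      ≤ ∑ T, α T * (β * (∑ i ∈ T, X i + independentCost g p)) :=
        Finset.sum_le_sum fun T _ => mul_le_mul_of_nonneg_left (haverage T) (hα.1.1 T)
    _ = β * (∑ T, α T * ∑ i ∈ T, X i + (∑ T, α T) * independentCost g p) := by
        rw [Finset.sum_mul, ← Finset.sum_add_distrib, Finset.mul_sum]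
        exact Finset.sum_congr rfl fun T _ => by ring
    _ = β * (∑ i, p i * X i + independentCost g p) := by
        rw [← sum_mul_marginal hα, hα.1.2, one_mul]
    _ ≤ 2 * β * independentCost g p := by
        nlinarith [mul_le_mul_of_nonneg_left hshares hβ]

end CostShares

/-! ### Separated nets -/

/-- Greedy selection in the order of the radii: a set of centres whose balls are pairwise far apart,
such that every centre is close to a selected one of no larger radius. -/
theorem exists_separated_net {F M : Type*} [DecidableEq F] [PseudoMetricSpace M]
    (loc : F → M) {t : F → ℝ} (ht : ∀ j, 0 ≤ t j) (U : Finset F) :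
    ∃ A ⊆ U, (∀ j ∈ A, ∀ k ∈ A, j ≠ k → 2 * t j < dist (loc j) (loc k)) ∧
      ∀ k ∈ U, ∃ j ∈ A, t j ≤ t k ∧ dist (loc k) (loc j) ≤ 2 * t k := by
  induction U using Finset.induction_on_max_value t with
  | empty => exact ⟨∅, by simp⟩
  | insert a U haU hmax ih =>
    obtain ⟨A, hAU, hsep, hnet⟩ := ih
    by_cases h : ∃ j ∈ A, dist (loc a) (loc j) ≤ 2 * t a
    · obtain ⟨j, hj, hd⟩ := h
      refine ⟨A, hAU.trans (Finset.subset_insert _ _), hsep, fun k hk => ?_⟩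
      rcases Finset.mem_insert.mp hk with rfl | hk
      · exact ⟨j, hj, hmax j (hAU hj), hd⟩
      · exact hnet k hk
    · push Not at h
      refine ⟨insert a A, Finset.insert_subset_insert _ hAU, fun j hj k hk hjk => ?_,
        fun k hk => ?_⟩
      · rcases Finset.mem_insert.mp hj with rfl | hjA <;>
          rcases Finset.mem_insert.mp hk with rfl | hkA
        · exact absurd rfl hjk
        · exact h k hkA
        · rw [dist_comm]
          exact (mul_le_mul_of_nonneg_left (hmax j (hAU hjA)) zero_le_two).trans_lt (h j hjA)
        · exact hsep j hjA k hkA hjk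
      · rcases Finset.mem_insert.mp hk with rfl | hk
        · exact ⟨k, Finset.mem_insert_self _ _, le_rfl, by
            rw [dist_self]; exact mul_nonneg zero_le_two (ht k)⟩
        · obtain ⟨j, hj, h1, h2⟩ := hnet k hk
          exact ⟨j, Finset.mem_insert_of_mem hj, h1, h2⟩

/-! ### First- and second-stage costs -/

namespace SUFLInstance

variable {V F M : Type*} [PseudoMetricSpace M]

theorem secondStageOpeningCost_nonneg [DecidableEq F] (I : SUFLInstance V F M) (x : Finset F)
    (j : F) :
    0 ≤ I.secondStageOpeningCost x j := by
  unfold secondStageOpeningCost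
  split_ifs
  · exact le_rfl
  · exact (I.firstCost_nonneg j).trans (I.firstCost_lt_secondCost j).le

theorem expectedCost_cost [Fintype V] [DecidableEq V] [DecidableEq F] (I : SUFLInstance V F M)
    (x : Finset F) {p : V → ℝ} {α : Finset V → ℝ} (hα : α ∈ distributionsWithMarginals p) :
    expectedCost α (I.cost x) = ∑ j ∈ x, I.firstCost j +
      expectedCost α (I.uflCost (I.secondStageOpeningCost x)) := by
  simp only [expectedCost, cost, mul_add]
  rw [Finset.sum_add_distrib, ← Finset.sum_mul, hα.1.2, one_mul]

/-! ### Cost shares for facility location -/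

/-- The average costs of the stars centred at the facility `j` with leaves in `S`. -/
def starCosts (I : SUFLInstance V F M) (w : F → ℝ) (S : Finset V) (j : F) : Set ℝ :=
  (fun A : Finset V => (w j + ∑ i ∈ A, dist (I.cityLoc i) (I.facilityLoc j)) / A.card) ''
    {A | A ⊆ S ∧ A.Nonempty}

/-- The time `t` at which the growing balls around the cities of `S` have paid for the facility `j`,
that is, `∑ i ∈ S, max 0 (t - d i j) = w j`. It is the least average cost of a star centred at `j`,
as `∑ i ∈ S, max 0 (t - d i j)` is the maximum of `∑ i ∈ A, (t - d i j)` over `A ⊆ S`.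
For empty `S` no star exists and the value is the meaningless `sInf ∅ = 0`; monotonicity in `S` and
cost recovery therefore need `S` nonempty. -/
def paymentTime (I : SUFLInstance V F M) (w : F → ℝ) (S : Finset V) (j : F) : ℝ :=
  sInf (I.starCosts w S j)

theorem starCosts_finite (I : SUFLInstance V F M) (w : F → ℝ) (S : Finset V) (j : F) :
    (I.starCosts w S j).Finite :=
  (S.powerset.finite_toSet.subset fun _ hA => by simpa using hA.1).image _

theorem starCosts_nonempty (I : SUFLInstance V F M) (w : F → ℝ) {S : Finset V} (hS : S.Nonempty)
    (j : F) : (I.starCosts w S j).Nonempty :=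
  ⟨_, S, ⟨subset_rfl, hS⟩, rfl⟩

theorem paymentTime_nonneg (I : SUFLInstance V F M) {w : F → ℝ} (hw : ∀ j, 0 ≤ w j)
    (S : Finset V) (j : F) : 0 ≤ I.paymentTime w S j := by
  refine Real.sInf_nonneg ?_
  rintro _ ⟨A, -, rfl⟩
  exact div_nonneg (add_nonneg (hw j) (Finset.sum_nonneg fun _ _ => dist_nonneg))
    (Nat.cast_nonneg _)

theorem paymentTime_anti (I : SUFLInstance V F M) (w : F → ℝ) {S T : Finset V}
    (hS : S.Nonempty) (hST : S ⊆ T) (j : F) : I.paymentTime w T j ≤ I.paymentTime w S j :=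
  csInf_le_csInf (I.starCosts_finite w T j).bddBelow (I.starCosts_nonempty w hS j)
    (Set.image_mono fun _ hA => ⟨hA.1.trans hST, hA.2⟩)

theorem sum_paymentTime_sub_le (I : SUFLInstance V F M) {w : F → ℝ} (hw : ∀ j, 0 ≤ w j)
    {S A : Finset V} (hA : A ⊆ S) (j : F) :
    ∑ i ∈ A, (I.paymentTime w S j - dist (I.cityLoc i) (I.facilityLoc j)) ≤ w j := by
  rcases A.eq_empty_or_nonempty with rfl | hne
  · simpa using hw j
  have h : I.paymentTime w S j ≤
      (w j + ∑ i ∈ A, dist (I.cityLoc i) (I.facilityLoc j)) / A.card :=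
    csInf_le (I.starCosts_finite w S j).bddBelow ⟨A, ⟨hA, hne⟩, rfl⟩
  rw [le_div_iff₀ (Nat.cast_pos.mpr hne.card_pos)] at h
  rw [Finset.sum_sub_distrib, Finset.sum_const, nsmul_eq_mul]
  linarith

theorem openingCost_le_sum_max (I : SUFLInstance V F M) (w : F → ℝ) {S : Finset V}
    (hS : S.Nonempty) (j : F) :
    w j ≤ ∑ i ∈ S, max 0 (I.paymentTime w S j - dist (I.cityLoc i) (I.facilityLoc j)) := by
  obtain ⟨A, ⟨hA, hne⟩, h⟩ :=
    (I.starCosts_nonempty w hS j).csInf_mem (I.starCosts_finite w S j)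
  change _ = I.paymentTime w S j at h
  have hcard : (A.card : ℝ) ≠ 0 := Nat.cast_ne_zero.mpr hne.card_ne_zero
  rw [div_eq_iff hcard] at h
  calc w j = ∑ i ∈ A, (I.paymentTime w S j - dist (I.cityLoc i) (I.facilityLoc j)) := by
        rw [Finset.sum_sub_distrib, Finset.sum_const, nsmul_eq_mul]
        linarith
    _ ≤ ∑ i ∈ A, max 0 (I.paymentTime w S j - dist (I.cityLoc i) (I.facilityLoc j)) :=
        Finset.sum_le_sum fun _ _ => le_max_right _ _
    _ ≤ _ := Finset.sum_le_sum_of_subset_of_nonneg hA fun _ _ _ => le_max_left _ _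

theorem uflCost_le [Fintype V] [Fintype F] [Nonempty F] (I : SUFLInstance V F M) (w : F → ℝ)
    {S : Finset V} {A : Finset F} {σ : V → F} (hσ : ∀ i ∈ S, σ i ∈ A) :
    I.uflCost w S ≤ ∑ j ∈ A, w j + ∑ i ∈ S, dist (I.cityLoc i) (I.facilityLoc (σ i)) :=
  (I.isLeast_uflCost w S).2 ⟨A, σ, hσ, rfl⟩

theorem uflCost_mono [Fintype V] [Fintype F] [Nonempty F] (I : SUFLInstance V F M) (w : F → ℝ) :
    Monotone (I.uflCost w : Finset V → ℝ) := by
  intro S T hST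
  obtain ⟨A, σ, hσ, h⟩ := (I.isLeast_uflCost w T).1
  rw [h]
  refine (I.uflCost_le w fun i hi => hσ i (hST hi)).trans ?_
  gcongr

theorem uflCost_nonneg [Fintype V] [Fintype F] [Nonempty F] (I : SUFLInstance V F M) {w : F → ℝ}
    (hw : ∀ j, 0 ≤ w j) (S : Finset V) : 0 ≤ I.uflCost w S := by
  obtain ⟨A, σ, -, h⟩ := (I.isLeast_uflCost w S).1
  rw [h]
  exact add_nonneg (Finset.sum_nonneg fun j _ => hw j) (Finset.sum_nonneg fun _ _ => dist_nonneg)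

variable [Fintype F] [Nonempty F]

/-- The cost share of the city `i` in the set `S`: the first time at which the ball growing around
`i` contains a facility that is paid for. -/
def costShare (I : SUFLInstance V F M) (w : F → ℝ) (i : V) (S : Finset V) : ℝ :=
  Finset.univ.inf' Finset.univ_nonempty fun j =>
    max (I.paymentTime w S j) (dist (I.cityLoc i) (I.facilityLoc j))

theorem costShare_le (I : SUFLInstance V F M) (w : F → ℝ) (i : V) (S : Finset V) (j : F) :
    I.costShare w i S ≤ max (I.paymentTime w S j) (dist (I.cityLoc i) (I.facilityLoc j)) :=
  Finset.inf'_le _ (Finset.mem_univ j)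

theorem costShare_nonneg (I : SUFLInstance V F M) (w : F → ℝ) (i : V) (S : Finset V) :
    0 ≤ I.costShare w i S :=
  Finset.le_inf' _ _ fun _ _ => le_max_of_le_right dist_nonneg

theorem exists_paymentTime_le_costShare (I : SUFLInstance V F M) (w : F → ℝ) (i : V)
    (S : Finset V) : ∃ j, I.paymentTime w S j ≤ I.costShare w i S ∧
      dist (I.cityLoc i) (I.facilityLoc j) ≤ I.costShare w i S := by
  obtain ⟨j, -, hj⟩ := Finset.exists_mem_eq_inf' Finset.univ_nonempty fun j =>
    max (I.paymentTime w S j) (dist (I.cityLoc i) (I.facilityLoc j))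
  exact ⟨j, (le_max_left _ _).trans_eq hj.symm, (le_max_right _ _).trans_eq hj.symm⟩

theorem costShare_anti (I : SUFLInstance V F M) (w : F → ℝ) {S T : Finset V} (hST : S ⊆ T) {i : V}
    (hi : i ∈ S) : I.costShare w i T ≤ I.costShare w i S :=
  Finset.le_inf' _ _ fun j _ => (I.costShare_le w i T j).trans
    (max_le_max_right _ (I.paymentTime_anti w ⟨i, hi⟩ hST j))

/-- The cities served by one facility are charged at most the cost of their star. -/
theorem sum_costShare_le_star (I : SUFLInstance V F M) {w : F → ℝ} (hw : ∀ j, 0 ≤ w j)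
    {S A : Finset V} (hA : A ⊆ S) (j : F) :
    ∑ i ∈ A, I.costShare w i S ≤ w j + ∑ i ∈ A, dist (I.cityLoc i) (I.facilityLoc j) := by
  classical
  calc ∑ i ∈ A, I.costShare w i S
      ≤ ∑ i ∈ A, ((if dist (I.cityLoc i) (I.facilityLoc j) < I.paymentTime w S j then
          I.paymentTime w S j - dist (I.cityLoc i) (I.facilityLoc j) else 0) +
            dist (I.cityLoc i) (I.facilityLoc j)) := by
        refine Finset.sum_le_sum fun i _ => (I.costShare_le w i S j).trans ?_
        split_ifs with h
        · exact max_le (by linarith) (by linarith)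
        · exact max_le (by linarith) (by linarith)
    _ ≤ w j + ∑ i ∈ A, dist (I.cityLoc i) (I.facilityLoc j) := by
        rw [Finset.sum_add_distrib, ← Finset.sum_filter]
        gcongr
        exact I.sum_paymentTime_sub_le hw ((Finset.filter_subset _ _).trans hA) j

theorem sum_costShare_le_uflCost [Fintype V] (I : SUFLInstance V F M) {w : F → ℝ}
    (hw : ∀ j, 0 ≤ w j) (S : Finset V) : ∑ i ∈ S, I.costShare w i S ≤ I.uflCost w S := by
  classical
  obtain ⟨A, σ, hσ, h⟩ := (I.isLeast_uflCost w S).1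
  rw [h, ← Finset.sum_fiberwise_of_maps_to hσ, ← Finset.sum_fiberwise_of_maps_to hσ
    (fun i => dist (I.cityLoc i) (I.facilityLoc (σ i))), ← Finset.sum_add_distrib]
  refine Finset.sum_le_sum fun j _ =>
    (I.sum_costShare_le_star hw (Finset.filter_subset _ _) j).trans_eq ?_
  congr 1
  refine Finset.sum_congr rfl fun i hi => ?_
  rw [(Finset.mem_filter.mp hi).2]

/-- Three times the shares pay for a separated net of facilities and for the connection of every
city to one of them. -/
theorem uflCost_le_three_mul_sum_costShare [Fintype V] (I : SUFLInstance V F M) {w : F → ℝ}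
    (hw : ∀ j, 0 ≤ w j) (S : Finset V) :
    I.uflCost w S ≤ 3 * ∑ i ∈ S, I.costShare w i S := by
  classical
  rcases S.eq_empty_or_nonempty with rfl | hS
  · simpa using I.uflCost_le w (S := ∅) (A := ∅) (σ := fun _ => Classical.arbitrary F) (by simp)
  set t := I.paymentTime w S with ht
  obtain ⟨A, -, hsep, hnet⟩ := exists_separated_net I.facilityLoc
    (I.paymentTime_nonneg hw S) Finset.univ
  -- The cost charged to the city `i` if it is connected to the facility `j`.
  have hcity : ∀ i, ∃ j ∈ A,
      ∑ k ∈ A, max 0 (t k - dist (I.cityLoc i) (I.facilityLoc k)) +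
        dist (I.cityLoc i) (I.facilityLoc j) ≤ 3 * I.costShare w i S := by
    intro i
    obtain ⟨k, htk, hdk⟩ := I.exists_paymentTime_le_costShare w i S
    obtain ⟨l, hl, htl, hdl⟩ := hnet k (Finset.mem_univ k)
    have hil : dist (I.cityLoc i) (I.facilityLoc l) ≤ 3 * I.costShare w i S := by
      linarith [dist_triangle (I.cityLoc i) (I.facilityLoc k) (I.facilityLoc l)]
    by_cases h : ∃ j ∈ A, dist (I.cityLoc i) (I.facilityLoc j) < t j
    · obtain ⟨j, hj, hij⟩ := h
      refine ⟨j, hj, ?_⟩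
      -- By separation, `j` is the only facility of the net that `i` helps to pay for.
      have hsingle : ∑ k ∈ A, max 0 (t k - dist (I.cityLoc i) (I.facilityLoc k)) =
          max 0 (t j - dist (I.cityLoc i) (I.facilityLoc j)) := by
        refine Finset.sum_eq_single_of_mem j hj fun m hm hmj => max_eq_left ?_
        have h1 := hsep m hm j hj hmj
        have h2 := hsep j hj m hm hmj.symm
        rw [dist_comm] at h2
        linarith [dist_triangle_left (I.facilityLoc m) (I.facilityLoc j) (I.cityLoc i)]
      rw [hsingle, max_eq_right (by linarith), sub_add_cancel]
      by_cases hjl : j = l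
      · subst hjl
        linarith [I.costShare_nonneg w i S]
      · linarith [hsep j hj l hl hjl,
          dist_triangle_left (I.facilityLoc j) (I.facilityLoc l) (I.cityLoc i)]
    · push Not at h
      refine ⟨l, hl, ?_⟩
      rw [Finset.sum_eq_zero fun m hm => max_eq_left (by linarith [h m hm]), zero_add]
      exact hil
  choose σ hσ hcost using hcity
  calc I.uflCost w S
      ≤ ∑ j ∈ A, w j + ∑ i ∈ S, dist (I.cityLoc i) (I.facilityLoc (σ i)) :=
        I.uflCost_le w fun i _ => hσ i
    _ ≤ ∑ j ∈ A, ∑ i ∈ S, max 0 (t j - dist (I.cityLoc i) (I.facilityLoc j)) +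
          ∑ i ∈ S, dist (I.cityLoc i) (I.facilityLoc (σ i)) := by
        gcongr with j
        exact I.openingCost_le_sum_max w hS j
    _ = ∑ i ∈ S, (∑ j ∈ A, max 0 (t j - dist (I.cityLoc i) (I.facilityLoc j)) +
          dist (I.cityLoc i) (I.facilityLoc (σ i))) := by
        rw [Finset.sum_comm, Finset.sum_add_distrib]
    _ ≤ 3 * ∑ i ∈ S, I.costShare w i S := by
        rw [Finset.mul_sum]
        exact Finset.sum_le_sum fun i _ => hcost i

/-! ### The correlation gap of the two-stage problem -/

variable [DecidableEq F] [Fintype V] [DecidableEq V]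

theorem independentCost_cost_nonneg (I : SUFLInstance V F M) (x : Finset F) {p : V → ℝ}
    (hp : ∀ i, p i ∈ Set.Icc (0 : ℝ) 1) : 0 ≤ independentCost (I.cost x) p :=
  Finset.sum_nonneg fun S _ => mul_nonneg ((independentDistribution_mem hp).1.1 S)
    (add_nonneg (Finset.sum_nonneg fun j _ => I.firstCost_nonneg j)
      (I.uflCost_nonneg (I.secondStageOpeningCost_nonneg x) S))

theorem worstCaseCost_le (I : SUFLInstance V F M) (x : Finset F) {p : V → ℝ}
    (hp : ∀ i, p i ∈ Set.Icc (0 : ℝ) 1) :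
    worstCaseCost (I.cost x) p ≤ 6 * independentCost (I.cost x) p := by
  obtain ⟨α, hα, h⟩ := (isGreatest_worstCaseCost (I.cost x) hp).1
  have hw := I.secondStageOpeningCost_nonneg x
  have hgap := expectedCost_le_of_crossMonotone hp hα (by norm_num : (0 : ℝ) ≤ 3)
    (I.uflCost_mono (I.secondStageOpeningCost x))
    (fun S i _ => I.costShare_nonneg (I.secondStageOpeningCost x) i S)
    (fun S T hST i hi => I.costShare_anti _ hST hi)
    (I.sum_costShare_le_uflCost hw) (I.uflCost_le_three_mul_sum_costShare hw)
  have hfirst : 0 ≤ ∑ j ∈ x, I.firstCost j := Finset.sum_nonneg fun j _ => I.firstCost_nonneg j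
  rw [← h]
  simp only [independentCost] at hgap ⊢
  rw [I.expectedCost_cost x hα, I.expectedCost_cost x (independentDistribution_mem hp)]
  linarith

end SUFLInstance

end

theorem mainTheorem4 :
    ∃ C : ℝ, ∀ (V F M : Type*) [Fintype V] [DecidableEq V] [Fintype F] [DecidableEq F]
      [Nonempty F] [PseudoMetricSpace M] (I : SUFLInstance V F M) (x : Finset F) (p : V → ℝ),
      (∀ i, p i ∈ Set.Icc (0 : ℝ) 1) → 2 ≤ Fintype.card V →
        correlationGap (I.cost x) p ≤ C * Real.log (Fintype.card V) ∧
        (independentCost (I.cost x) p = 0 → worstCaseCost (I.cost x) p = 0) := by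
  refine ⟨6 / Real.log 2, fun V F M _ _ _ _ _ _ I x p hp hn => ⟨?_, fun h0 => ?_⟩⟩
  · have hlog2 : 0 < Real.log 2 := Real.log_pos one_lt_two
    have hlog : Real.log 2 ≤ Real.log (Fintype.card V) :=
      Real.log_le_log two_pos (by exact_mod_cast hn)
    have hgap : correlationGap (I.cost x) p ≤ 6 :=
      div_le_of_le_mul₀ (I.independentCost_cost_nonneg x hp) (by norm_num)
        (I.worstCaseCost_le x hp)
    calc correlationGap (I.cost x) p ≤ 6 := hgap
      _ = 6 / Real.log 2 * Real.log 2 := (div_mul_cancel₀ _ hlog2.ne').symm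
      _ ≤ 6 / Real.log 2 * Real.log (Fintype.card V) :=
          mul_le_mul_of_nonneg_left hlog (by positivity)
  · have hle := I.worstCaseCost_le x hp
    have hge : independentCost (I.cost x) p ≤ worstCaseCost (I.cost x) p :=
      (isGreatest_worstCaseCost (I.cost x) hp).2 ⟨_, independentDistribution_mem hp, rfl⟩
    linarith
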